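/- Let $q$ be a prime power and $n\ge 2$. Let $V$ be a $2n$-dimensional vector space over $\mathrm{GF}(q^2)$ with a non-degenerate alternating form $B$, let $\varphi:\mathrm{GF}(q^2)\to\mathrm{GF}(q)$ be a nonzero $\mathrm{GF}(q)$-linear map, and regard $V$ as a $4n$-dimensional vector space over $\mathrm{GF}(q)$ with the form $f=\varphi\circ B$. Then $f$ is a non-degenerate alternating form; let $\mathcal W(4n-1,q)$ be the symplectic polar space of $\mathrm{PG}(4n-1,q)$ that it defines, and $\perp$ the associated polarity. Let $\mathcal F$ be Dye's spread, i.e. the set of the one-dimensional $\mathrm{GF}(q^2)$-subspaces of $V$, regarded as lines of $\mathrm{PG}(4n-1,q)$. Let $\mathcal O_1$ be the set of totally isotropic lines $\ell$ such that $\ell\not\subseteq s^\perp$ for every $s\in\mathcal F$ that meets $\ell$ non-trivially, and let $\mathcal O_2$ be the set of totally isotropic lines $\ell\notin\mathcal F$ such that $\ell\subseteq s^\perp$ for every $s\in\mathcal F$ that meets $\ell$ non-trivially. Put $\theta_{k,q}=q^k+\dots+q+1$. For $r$ odd, $r\ge 3$, a set $\mathcal L$ of totally isotropic lines of $\mathcal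 W(r,q)$ is an $m$-cover, where $0<m<\theta_{r-1,q}$, if every point of $\mathrm{PG}(r,q)$ lies on exactly $m$ lines of $\mathcal L$. It is $(r-2)$-dual of symplectic type if moreover, for every line $\ell$ of $\mathrm{PG}(r,q)$, $$|\{s\in\mathcal L: s\subseteq \ell^\perp\}|=\begin{cases}\dfrac{m\,\theta_{r-4,q}}{q+1}+q^{r-3}&\text{if }\ell\in\mathcal L,\\[2mm] \dfrac{m\,\theta_{r-4,q}}{q+1}&\text{if }\ell\notin\mathcal L,\end{cases}$$ with $\theta_{-1,q}=0$. Then $\mathcal F$ is a $1$-cover (a spread) of $\mathcal W(4n-1,q)$, each of $\mathcal O_1$, $\mathcal O_2$ is an $m$-cover of $\mathcal W(4n-1,q)$ for some $m$ (depending on the set), and all three covers are $(4n-3)$-dual of symplectic type. -/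

import Mathlib

open LinearMap (BilinForm)

/-- `qNumber q k = 1 + q + ⋯ + q ^ (k - 1)`, the number of points of `PG(k - 1, q)`; in the usual
notation this is `θ_{k-1,q}`, with `θ_{-1,q} = 0`. -/
def qNumber (q k : ℕ) : ℕ := ∑ i ∈ Finset.range k, q ^ i

section PolarSpace

variable {F V : Type*} [Field F] [AddCommGroup V] [Module F V]

/-- The form `f` on `V` defines a symplectic polar space `W(r, q)` of `PG(V) = PG(r, q)`, where
`q = |F|`. The associated polarity sends a subspace `U` to `f.orthogonal U`. -/
structure IsSymplecticPolarSpace (r : ℕ) (f : BilinForm F V) : Prop where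
  finrank_eq : Module.finrank F V = r + 1
  isAlt : f.IsAlt
  nondegenerate : f.Nondegenerate

/-- A subspace of `V` which is a line of the projective space `PG(V)`. -/
def IsProjLine (ℓ : Submodule F V) : Prop := Module.finrank F ℓ = 2

/-- The lines of the polar space of `f`: the totally isotropic lines of `PG(V)`. -/
def isotropicLines (f : BilinForm F V) : Set (Submodule F V) :=
  {ℓ | IsProjLine ℓ ∧ ℓ ≤ f.orthogonal ℓ}

/-- `L` is an `m`-cover of the symplectic polar space `W(r, q)` defined by `f`: a set of totally
isotropic lines such that every point lies on exactly `m` of them, where `0 < m < θ_{r-1,q}`. -/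
structure IsCover (r : ℕ) (f : BilinForm F V) (m : ℕ) (L : Set (Submodule F V)) : Prop where
  symplectic : IsSymplecticPolarSpace r f
  subset_lines : L ⊆ isotropicLines f
  pos : 0 < m
  lt : m < qNumber (Nat.card F) r
  card_through : ∀ P : Submodule F V, Module.finrank F P = 1 → {ℓ ∈ L | P ≤ ℓ}.ncard = m

/-- `L` is an `(r - 2)`-dual `m`-cover of symplectic type of `W(r, q)`: for every line `ℓ` of
`PG(r, q)`, the number of lines of `L` in the `(r - 2)`-space `ℓ^⊥` is
`m θ_{r-4,q} / (q + 1) + q ^ (r - 3)` if `ℓ ∈ L`, and `m θ_{r-4,q} / (q + 1)` if `ℓ ∉ L`. -/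
structure IsDualCoverOfSymplecticType (r : ℕ) (f : BilinForm F V) (m : ℕ)
    (L : Set (Submodule F V)) : Prop where
  cover : IsCover r f m L
  card_of_mem : ∀ ℓ : Submodule F V, IsProjLine ℓ → ℓ ∈ L →
    ({s ∈ L | s ≤ f.orthogonal ℓ}.ncard : ℚ) =
      (m : ℚ) * (qNumber (Nat.card F) (r - 3) : ℚ) / ((Nat.card F : ℚ) + 1)
        + (Nat.card F : ℚ) ^ (r - 3)
  card_of_not_mem : ∀ ℓ : Submodule F V, IsProjLine ℓ → ℓ ∉ L →
    ({s ∈ L | s ≤ f.orthogonal ℓ}.ncard : ℚ) =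
      (m : ℚ) * (qNumber (Nat.card F) (r - 3) : ℚ) / ((Nat.card F : ℚ) + 1)

/-- The totally isotropic lines that are conjugate to no member of the spread `S` which they meet
non-trivially. -/
def nonConjugateLines (f : BilinForm F V) (S : Set (Submodule F V)) : Set (Submodule F V) :=
  {ℓ ∈ isotropicLines f | ∀ s ∈ S, s ⊓ ℓ ≠ ⊥ → ¬ ℓ ≤ f.orthogonal s}

/-- The totally isotropic lines outside the spread `S` that are conjugate to every member of `S`
which they meet non-trivially. -/
def conjugateLines (f : BilinForm F V) (S : Set (Submodule F V)) : Set (Submodule F V) :=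
  {ℓ ∈ isotropicLines f | ℓ ∉ S ∧ ∀ s ∈ S, s ⊓ ℓ ≠ ⊥ → ℓ ≤ f.orthogonal s}

end PolarSpace

section Dye

variable {F K V : Type*} [Field F] [Field K] [Algebra F K] [AddCommGroup V]
  [Module K V] [Module F V] [IsScalarTower F K V]

/-- The `F`-bilinear form `(x, y) ↦ φ (B x y)` obtained from a `K`-bilinear form `B` and an
`F`-linear functional `φ` on `K`. For `K / F` quadratic and `φ` ranging over the nonzero
functionals, the forms `φ ∘ B` are those of the pencil of linear complexes fixed by `Sp(B)`. -/
def reducedForm (φ : K →ₗ[F] F) (B : BilinForm K V) : BilinForm F V :=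
  LinearMap.mk₂ F (fun x y => φ (B x y))
    (fun x x' y => by simp)
    (fun c x y => by
      rw [← algebraMap_smul K c x, map_smul, LinearMap.smul_apply, algebraMap_smul, map_smul])
    (fun x y y' => by simp)
    (fun c x y => by
      rw [← algebraMap_smul K c y, map_smul, algebraMap_smul, map_smul])

@[simp]
theorem reducedForm_apply (φ : K →ₗ[F] F) (B : BilinForm K V) (x y : V) :
    reducedForm φ B x y = φ (B x y) := rfl

/-- Dye's spread of `PG(V)`, `V` as a vector space over `F`: its members are the points of the
projective space of `V` over the quadratic extension `K`, regarded as lines over `F`. -/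
def dyeSpread (F K V : Type*) [Field F] [Field K] [Algebra F K] [AddCommGroup V]
    [Module K V] [Module F V] [IsScalarTower F K V] : Set (Submodule F V) :=
  {s | ∃ p : Submodule K V, Module.finrank K p = 1 ∧ s = p.restrictScalars F}

end Dye

/-! ### Incidence counts for projective lines -/

section Counting

open Submodule Finset
open scoped Classical

variable {F V : Type*} [Field F] [AddCommGroup V] [Module F V]

/-! Let `S` be Dye's spread, `T` the `F`-lines on which `B` vanishes, and `I` the totally isotropic
lines of `f = φ ∘ B`; then `S ⊆ T ⊆ I`. If a spread member `s` meets a line `ℓ` in `w ≠ 0`, then `ℓ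
≤ s^⊥` means `B w y = 0` for all `y ∈ ℓ`, which forces `ℓ ∈ T` whichever `s` was chosen. Hence `O₁ =
I \ T` and `O₂ = T \ S`. The defining equations are linear in `m` and in the indicator of `ℓ ∈ L`,
so differences of nested dual covers are again dual covers (`IsDualCoverOfSymplecticType.sdiff`),
and it remains to treat `S`, `T` and `I`.

`T` and `I` are one case (`isDualCover_vanishingLines`): the `F`-lines on which an `E`-bilinear form
vanishes, with `E = K`, or with `E = F` and `φ = id`. Counting flags `u ∈ s ≤ ℓ^⊥`, the lines `s`
through `u` are governed by `|(ℓ + Eu)^⊥|`, hence by `|ℓ ∩ Eu|`. Summed over `u`, this reduces to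
counting, for `w ∈ ℓ`, the scalars `k` with `k • w ∈ ℓ^⊥`: all of `E` if `B` vanishes on `ℓ`, a
hyperplane of `E` otherwise. This dichotomy produces the term `q ^ (r - 3)`.

For `S` (`isDualCover_dyeSpread`), the members inside `ℓ^⊥` partition the nonzero vectors of
`(Kℓ)^⊥`, and `Kℓ` has `F`-dimension 2 or 4 according to whether `ℓ ∈ S`. -/

theorem isProjLine_span_pair {u v : V} (hu : u ≠ 0) (hv : v ∉ span F {u}) :
    IsProjLine (span F {u, v}) := by
  have h : LinearIndependent F ![u, v] := by
    rw [LinearIndependent.pair_iff' hu]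
    intro a ha
    exact hv (mem_span_singleton.2 ⟨a, ha⟩)
  rw [IsProjLine, ← Matrix.range_cons_cons_empty u v ![], finrank_span_eq_card h, Fintype.card_fin]

theorem IsProjLine.eq_span_pair [Finite V] {ℓ : Submodule F V} (hℓ : IsProjLine ℓ) {u v : V}
    (hu : u ≠ 0) (hv : v ∉ span F {u}) (huℓ : u ∈ ℓ) (hvℓ : v ∈ ℓ) : ℓ = span F {u, v} := by
  have : Module.Finite F V := Module.Finite.of_finite
  refine (eq_of_le_of_finrank_eq (span_le.2 ?_) ?_).symm
  · rintro x (rfl | rfl) <;> assumption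
  · rw [isProjLine_span_pair hu hv, hℓ]

theorem Submodule.natCard_eq_pow [Finite V] (U : Submodule F V) :
    Nat.card U = Nat.card F ^ Module.finrank F U :=
  have : Module.Finite F V := Module.Finite.of_finite
  Module.natCard_eq_pow_finrank

theorem Submodule.ncard_coe (U : Submodule F V) : (U : Set V).ncard = Nat.card U := rfl

theorem IsProjLine.exists_notMem_span [Finite V] {ℓ : Submodule F V} (hℓ : IsProjLine ℓ) {u : V}
    (hu : u ≠ 0) : ∃ v ∈ ℓ, v ∉ span F {u} := by
  have : Module.Finite F V := Module.Finite.of_finite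
  by_contra! h
  have := Submodule.finrank_mono (s := ℓ) (t := span F {u}) h
  rw [finrank_span_singleton hu, hℓ] at this
  omega

theorem IsProjLine.ncard_sdiff_zero [Finite V] {ℓ : Submodule F V} (hℓ : IsProjLine ℓ) :
    {v | v ≠ 0 ∧ v ∈ ℓ}.ncard = Nat.card F ^ 2 - 1 := by
  have : {v | v ≠ 0 ∧ v ∈ ℓ} = (ℓ : Set V) \ {0} := by ext; simp [and_comm]
  rw [this, Set.ncard_sdiff_singleton_of_mem (by simp), ncard_coe, natCard_eq_pow, hℓ]

theorem IsProjLine.ncard_sdiff_span [Finite V] {ℓ : Submodule F V} (hℓ : IsProjLine ℓ) {u : V}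
    (hu : u ≠ 0) (huℓ : u ∈ ℓ) :
    {v | v ∉ span F {u} ∧ v ∈ ℓ}.ncard = Nat.card F ^ 2 - Nat.card F := by
  have : {v | v ∉ span F {u} ∧ v ∈ ℓ} = (ℓ : Set V) \ (span F {u} : Submodule F V) := by
    ext; simp [and_comm]
  rw [this, Set.ncard_sdiff (by simpa using huℓ), ncard_coe, ncard_coe, natCard_eq_pow,
    natCard_eq_pow, hℓ, finrank_span_singleton hu, pow_one]

/-- Double count of the incident pairs of a vector satisfying `A` and a line of `S`. -/
theorem sum_ncard_lines_through [Fintype V] (A : V → Prop) [DecidablePred A]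
    (S : Set (Submodule F V)) (c : ℕ)
    (hc : ∀ ℓ ∈ S, {v | A v ∧ v ∈ ℓ}.ncard = c) :
    ∑ v with A v, {ℓ ∈ S | v ∈ ℓ}.ncard = S.ncard * c := by
  have key := sum_card_bipartiteAbove_eq_sum_card_bipartiteBelow
    (s := univ.filter A) (t := S.toFinite.toFinset) (fun v ℓ => v ∈ ℓ)
  have h1 : ∀ v, {ℓ ∈ S | v ∈ ℓ}.ncard =
      #(S.toFinite.toFinset.bipartiteAbove (fun v ℓ => v ∈ ℓ) v) := by
    intro v
    rw [← Set.ncard_coe_finset]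
    congr 1
    ext; simp [bipartiteAbove]
  have h2 : ∀ ℓ ∈ S.toFinite.toFinset,
      #((univ.filter A).bipartiteBelow (fun v ℓ => v ∈ ℓ) ℓ) = c := by
    intro ℓ hℓ
    rw [← hc ℓ (by simpa using hℓ), ← Set.ncard_coe_finset]
    congr 1
    ext; simp [bipartiteBelow]
  simp_rw [h1]
  rw [key, sum_congr rfl h2, sum_const, smul_eq_mul, Set.ncard_eq_toFinset_card S]

theorem sum_ncard_lines_through_ne_zero [Fintype V] {S : Set (Submodule F V)}
    (hS : ∀ ℓ ∈ S, IsProjLine ℓ) :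
    ∑ v : V with v ≠ 0, {ℓ ∈ S | v ∈ ℓ}.ncard = S.ncard * (Nat.card F ^ 2 - 1) :=
  sum_ncard_lines_through _ S _ fun ℓ hℓ => (hS ℓ hℓ).ncard_sdiff_zero

/-- A vector outside `Fu` lies on exactly one line through `u`, and each such line carries `q² - q`
of these vectors. -/
theorem ncard_lines_through_mul [Fintype V] {S : Set (Submodule F V)}
    (hS : ∀ ℓ ∈ S, IsProjLine ℓ) {u : V} (hu : u ≠ 0) :
    {ℓ ∈ S | u ∈ ℓ}.ncard * (Nat.card F ^ 2 - Nat.card F) =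
      {v | v ∉ span F {u} ∧ span F {u, v} ∈ S}.ncard := by
  rw [← sum_ncard_lines_through (fun v => v ∉ span F {u}) {ℓ ∈ S | u ∈ ℓ} _
    fun ℓ hℓ => (hS ℓ hℓ.1).ncard_sdiff_span hu hℓ.2]
  have h : ∀ v ∈ univ.filter (fun v => v ∉ span F {u}),
      {ℓ ∈ {ℓ ∈ S | u ∈ ℓ} | v ∈ ℓ}.ncard = if span F {u, v} ∈ S then 1 else 0 := by
    intro v hv
    replace hv : v ∉ span F {u} := by simpa using hv
    split_ifs with h
    · rw [Set.ncard_eq_one]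
      refine ⟨span F {u, v}, ?_⟩
      ext ℓ
      constructor
      · rintro ⟨⟨h1, h2⟩, h3⟩
        exact (hS ℓ h1).eq_span_pair hu hv h2 h3
      · rintro rfl
        exact ⟨⟨h, mem_span_pair.2 ⟨1, 0, by simp⟩⟩, mem_span_pair.2 ⟨0, 1, by simp⟩⟩
    · rw [Set.ncard_eq_zero, Set.eq_empty_iff_forall_notMem]
      rintro ℓ ⟨⟨h1, h2⟩, h3⟩
      exact h ((hS ℓ h1).eq_span_pair hu hv h2 h3 ▸ h1)
  rw [sum_congr rfl h, sum_boole, filter_filter, Nat.cast_id, ← Set.ncard_coe_finset]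
  congr 1
  ext; simp

end Counting

/-! ### Lines on which an alternating form vanishes -/

section TotallyIsotropic

open Submodule Finset
open scoped Classical

variable {F E V : Type*} [Field F] [Field E] [Algebra F E] [AddCommGroup V]
  [Module E V] [Module F V] [IsScalarTower F E V]

/-- The lines of `PG(V)`, `V` as a vector space over the subfield `F` of `E`, on which the
`E`-bilinear form `B` vanishes. -/
def vanishingLines (F : Type*) [Field F] [Algebra F E] [Module F V] [IsScalarTower F E V]
    (B : BilinForm E V) : Set (Submodule F V) :=
  {ℓ | IsProjLine ℓ ∧ ∀ u ∈ ℓ, ∀ v ∈ ℓ, B u v = 0}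

theorem LinearMap.BilinForm.apply_eq_zero_of_mem_span_pair {B : BilinForm E V} (hB : B.IsAlt)
    {u v : V} (h : B u v = 0) :
    ∀ x ∈ span F {u, v}, ∀ y ∈ span F {u, v}, B x y = 0 := by
  have h' : B v u = 0 := hB.isRefl u v h
  intro x hx y hy
  obtain ⟨a, b, rfl⟩ := mem_span_pair.1 hx
  obtain ⟨c, d, rfl⟩ := mem_span_pair.1 hy
  simp [h, h', hB.self_eq_zero]

theorem LinearMap.BilinForm.apply_eq_zero_of_mem_span {B : BilinForm E V} (hB : B.IsAlt)
    {u v : V} (h : v ∈ span F {u}) : B u v = 0 := by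
  obtain ⟨a, rfl⟩ := mem_span_singleton.1 h
  simp [hB.self_eq_zero]

/-- As `B` is alternating, `B u v = 0` alone makes `B` vanish on the span of `u` and `v`. The
summand `q` restores the vectors of `Fu`, which span no line with `u`. -/
theorem ncard_vanishingLines_through [Finite F] [Fintype V] {B : BilinForm E V} (hB : B.IsAlt)
    (W : Submodule F V) {u : V} (hu : u ≠ 0) (huW : u ∈ W) :
    {ℓ ∈ {ℓ ∈ vanishingLines F B | ℓ ≤ W} | u ∈ ℓ}.ncard * (Nat.card F ^ 2 - Nat.card F)
      + Nat.card F = {v | v ∈ W ∧ B u v = 0}.ncard := by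
  rw [ncard_lines_through_mul (fun ℓ hℓ => hℓ.1.1) hu]
  have h1 : {v | v ∉ span F {u} ∧ span F {u, v} ∈ {ℓ ∈ vanishingLines F B | ℓ ≤ W}} =
      {v | v ∈ W ∧ B u v = 0} \ (span F {u} : Submodule F V) := by
    ext v
    simp only [Set.mem_ofPred_eq, Set.mem_sdiff, SetLike.mem_coe]
    constructor
    · rintro ⟨h1, h2, h3⟩
      exact ⟨⟨h3 (subset_span (by simp)), h2.2 _ (subset_span (by simp)) _
        (subset_span (by simp))⟩, h1⟩
    · rintro ⟨⟨h1, h2⟩, h3⟩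
      refine ⟨h3, ⟨isProjLine_span_pair hu h3,
        LinearMap.BilinForm.apply_eq_zero_of_mem_span_pair hB h2⟩, span_le.2 ?_⟩
      rintro x (rfl | rfl) <;> assumption
  have h2 : ((span F {u} : Submodule F V) : Set V).ncard = Nat.card F := by
    rw [ncard_coe, natCard_eq_pow, finrank_span_singleton hu, pow_one]
  rw [h1]
  conv_lhs => rw [← h2]
  refine Set.ncard_sdiff_add_ncard_of_subset fun v hv => ?_
  exact ⟨(span_le (p := W)).2 (by simpa using huW) hv,
    LinearMap.BilinForm.apply_eq_zero_of_mem_span hB hv⟩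

end TotallyIsotropic

/-! ### The reduced form and the flag count in `ℓ^⊥` -/

section ReducedForm

open Submodule Finset
open scoped Classical

variable {F E V : Type*} [Field F] [Field E] [Algebra F E] [AddCommGroup V]
  [Module E V] [Module F V] [IsScalarTower F E V]

/-- If `b ≠ 0`, its multiples fill `E`. This is what turns orthogonality of an `E`-subspace for `φ ∘
B` into orthogonality for `B`. -/
theorem LinearMap.eq_zero_of_forall_apply_mul_eq_zero {φ : E →ₗ[F] F} (hφ : φ ≠ 0) {b : E}
    (h : ∀ k, φ (k * b) = 0) : b = 0 := by
  by_contra hb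
  refine hφ (LinearMap.ext fun k => ?_)
  simpa [hb] using h (k * b⁻¹)

theorem reducedForm_isAlt (φ : E →ₗ[F] F) {B : BilinForm E V} (hB : B.IsAlt) :
    (reducedForm φ B).IsAlt := fun x => by simp [hB.self_eq_zero]

theorem reducedForm_nondegenerate {φ : E →ₗ[F] F} (hφ : φ ≠ 0) {B : BilinForm E V}
    (hB : B.IsAlt) (hB' : B.Nondegenerate) : (reducedForm φ B).Nondegenerate := by
  refine (reducedForm_isAlt φ hB).isRefl.nondegenerate_iff_separatingLeft.2 fun x hx => ?_
  refine hB'.1 x fun y => LinearMap.eq_zero_of_forall_apply_mul_eq_zero hφ fun k => ?_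
  simpa using hx (k • y)

theorem natCard_orthogonal_mul [Finite V] {f : BilinForm F V} (hf : f.Nondegenerate)
    (U : Submodule F V) :
    Nat.card (f.orthogonal U) * Nat.card U = Nat.card F ^ Module.finrank F V := by
  have : Module.Finite F V := Module.Finite.of_finite
  have h := U.finrank_le
  rw [natCard_eq_pow, natCard_eq_pow, LinearMap.BilinForm.finrank_orthogonal hf, ← pow_add]
  congr 1
  omega

theorem natCard_sup_mul_natCard_inf [Finite V] (U W : Submodule F V) :
    Nat.card (U ⊔ W : Submodule F V) * Nat.card (U ⊓ W : Submodule F V) =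
      Nat.card U * Nat.card W := by
  have : Module.Finite F V := Module.Finite.of_finite
  simp only [natCard_eq_pow, ← pow_add, finrank_sup_add_finrank_inf_eq]

theorem natCard_span_restrictScalars [Finite E] [Finite V] {u : V} (hu : u ≠ 0) :
    Nat.card ((span E {u}).restrictScalars F) = Nat.card F ^ Module.finrank F E := by
  have : Module.Finite F E := Module.Finite.of_finite
  rw [← Module.natCard_eq_pow_finrank (K := F) (V := E)]
  exact Nat.card_congr (LinearEquiv.toSpanNonzeroSingleton E V u hu).symm.toEquiv

theorem mem_orthogonal_span_iff {φ : E →ₗ[F] F} (hφ : φ ≠ 0) {B : BilinForm E V} {u v : V} :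
    v ∈ (reducedForm φ B).orthogonal ((span E {u}).restrictScalars F) ↔ B u v = 0 := by
  simp only [LinearMap.BilinForm.mem_orthogonal_iff, reducedForm_apply, restrictScalars_mem]
  constructor
  · refine fun h => LinearMap.eq_zero_of_forall_apply_mul_eq_zero hφ fun k => ?_
    simpa using h (k • u) (mem_span_singleton.2 ⟨k, rfl⟩)
  · rintro h n hn
    obtain ⟨k, rfl⟩ := mem_span_singleton.1 hn
    simp [h]

/-- The set is `(ℓ + Eu)^⊥`, and `|ℓ + Eu| · |ℓ ∩ Eu| = |ℓ| · |Eu|`. Denominators are cleared to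
stay in `ℕ`. -/
theorem ncard_orthogonal_inter [Finite E] [Finite V] {φ : E →ₗ[F] F} (hφ : φ ≠ 0)
    {B : BilinForm E V} (hB : B.IsAlt) (hB' : B.Nondegenerate) {ℓ : Submodule F V}
    (hℓ : IsProjLine ℓ) {u : V} (hu : u ≠ 0) :
    {v | v ∈ (reducedForm φ B).orthogonal ℓ ∧ B u v = 0}.ncard *
        Nat.card F ^ (2 + Module.finrank F E) =
      Nat.card F ^ Module.finrank F V *
        Nat.card (ℓ ⊓ (span E {u}).restrictScalars F : Submodule F V) := by
  have h1 : {v | v ∈ (reducedForm φ B).orthogonal ℓ ∧ B u v = 0} =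
      ((reducedForm φ B).orthogonal (ℓ ⊔ (span E {u}).restrictScalars F) : Set V) := by
    ext v
    simp only [Set.mem_ofPred_eq, SetLike.mem_coe, ← mem_orthogonal_span_iff (F := F) hφ,
      LinearMap.BilinForm.mem_orthogonal_iff]
    constructor
    · rintro ⟨h1, h2⟩ n hn
      obtain ⟨y, hy, z, hz, rfl⟩ := mem_sup.1 hn
      simp [h1 y hy, h2 z hz]
    · exact fun h => ⟨fun n hn => h n (mem_sup_left hn), fun n hn => h n (mem_sup_right hn)⟩
  rw [h1, ncard_coe, ← natCard_orthogonal_mul (reducedForm_nondegenerate hφ hB hB')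
    (ℓ ⊔ (span E {u}).restrictScalars F), mul_assoc, natCard_sup_mul_natCard_inf,
    natCard_eq_pow ℓ, hℓ, natCard_span_restrictScalars hu, pow_add]

/-- The map `k ↦ φ (k * b)` is a nonzero functional, so its kernel is a hyperplane; the `+ 1` is for
`k = 0`. -/
theorem ncard_ne_zero_apply_mul_eq_zero [Finite E] {φ : E →ₗ[F] F} (hφ : φ ≠ 0) {b : E}
    (hb : b ≠ 0) :
    ({k : E | k ≠ 0 ∧ φ (k * b) = 0}.ncard + 1) * Nat.card F =
      Nat.card F ^ Module.finrank F E := by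
  have : Module.Finite F E := Module.Finite.of_finite
  let g : E →ₗ[F] F := φ ∘ₗ LinearMap.mulRight F b
  have hg : g ≠ 0 := fun h => hb <| LinearMap.eq_zero_of_forall_apply_mul_eq_zero hφ
    fun k => LinearMap.congr_fun h k
  have h1 : {k : E | k ≠ 0 ∧ φ (k * b) = 0} = (LinearMap.ker g : Set E) \ {0} := by
    ext; simp [g, and_comm]
  have h2 := LinearMap.finrank_range_add_finrank_ker g
  rw [LinearMap.range_eq_top.2 (LinearMap.surjective hg), finrank_top, Module.finrank_self] at h2
  rw [h1, Set.ncard_sdiff_singleton_add_one (by simp), ncard_coe, natCard_eq_pow, ← h2, pow_add,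
    pow_one, mul_comm]

theorem ncard_ne_zero_mem_span (W : Set V) {w : V}
    (hw : w ≠ 0) :
    {u | (u ≠ 0 ∧ u ∈ W) ∧ w ∈ span E {u}}.ncard = {k : E | k ≠ 0 ∧ k • w ∈ W}.ncard := by
  rw [← Set.ncard_image_of_injective _ (smul_left_injective E hw)]
  congr 1
  ext u
  simp only [Set.mem_ofPred_eq, Set.mem_image]
  constructor
  · rintro ⟨⟨h1, h2⟩, h3⟩
    obtain ⟨a, rfl⟩ := mem_span_singleton.1 h3
    have ha : a ≠ 0 := by rintro rfl; simp at hw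
    exact ⟨a⁻¹, ⟨inv_ne_zero ha, by rwa [inv_smul_smul₀ ha]⟩, inv_smul_smul₀ ha u⟩
  · rintro ⟨k, ⟨h1, h2⟩, rfl⟩
    exact ⟨⟨smul_ne_zero h1 hw, h2⟩, mem_span_singleton.2 ⟨k⁻¹, inv_smul_smul₀ h1 w⟩⟩

theorem setOf_smul_mem_orthogonal_of_mem {φ : E →ₗ[F] F}
    {B : BilinForm E V} {ℓ : Submodule F V}
    (h : ℓ ∈ vanishingLines F B) {w : V} (hwℓ : w ∈ ℓ) :
    {k : E | k ≠ 0 ∧ k • w ∈ (reducedForm φ B).orthogonal ℓ} = Set.univ \ {0} := by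
  ext k
  simp only [Set.mem_ofPred_eq, LinearMap.BilinForm.mem_orthogonal_iff,
      reducedForm_apply, Set.mem_sdiff, Set.mem_univ, true_and,
      Set.mem_singleton_iff, and_iff_left_iff_imp]
  intro _ n hn
  simp [h.2 n hn w hwℓ]

/-- Write `ℓ` as the span of `w` and `y`. Since `B w w = 0`, only the condition at `y` remains, with
`b = B y w`; this is nonzero because `B` does not vanish on `ℓ`. -/
theorem exists_setOf_smul_mem_orthogonal_of_notMem [Finite V] (φ : E →ₗ[F] F)
    {B : BilinForm E V} (hB : B.IsAlt) {ℓ : Submodule F V} (hℓ : IsProjLine ℓ)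
    (h : ℓ ∉ vanishingLines F B) {w : V} (hw : w ≠ 0) (hwℓ : w ∈ ℓ) :
    ∃ b ≠ 0, {k : E | k ≠ 0 ∧ k • w ∈ (reducedForm φ B).orthogonal ℓ} =
      {k : E | k ≠ 0 ∧ φ (k * b) = 0} := by
  obtain ⟨y, hy, hyw⟩ := hℓ.exists_notMem_span hw
  have hs := hℓ.eq_span_pair hw hyw hwℓ hy
  refine ⟨B y w, fun h0 => h ⟨hℓ, ?_⟩, ?_⟩
  · rw [hs]
    exact LinearMap.BilinForm.apply_eq_zero_of_mem_span_pair hB (hB.isRefl y w h0)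
  · ext k
    simp only [Set.mem_ofPred_eq, LinearMap.BilinForm.mem_orthogonal_iff,
      reducedForm_apply, and_congr_right_iff]
    intro _
    constructor
    · intro hk
      simpa using hk y hy
    · intro hk n hn
      rw [hs] at hn
      obtain ⟨a, b, rfl⟩ := mem_span_pair.1 hn
      simp [hB.self_eq_zero, hk]

/-- Double count of pairs `(u, w)` with `w` nonzero in `ℓ ∩ Eu`, equivalently with `u` a nonzero
multiple of `w`. The zero vector of each intersection gives the first term on the right. -/
theorem sum_natCard_inf_span [Finite E] [Fintype V] (W : Submodule F V) {ℓ : Submodule F V}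
    (hℓ : IsProjLine ℓ) {c : ℕ}
    (hc : ∀ w ∈ ℓ, w ≠ 0 → {k : E | k ≠ 0 ∧ k • w ∈ W}.ncard = c) :
    ∑ u : V with u ≠ 0 ∧ u ∈ W,
        Nat.card (ℓ ⊓ (span E {u}).restrictScalars F : Submodule F V) =
      #{u : V | u ≠ 0 ∧ u ∈ W} + (Nat.card F ^ 2 - 1) * c := by
  have key := sum_card_bipartiteAbove_eq_sum_card_bipartiteBelow
    (s := univ.filter fun u : V => u ≠ 0 ∧ u ∈ W) (t := univ.filter fun w : V => w ≠ 0 ∧ w ∈ ℓ)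
    (fun u w => w ∈ span E {u})
  have h1 : ∀ u, Nat.card (ℓ ⊓ (span E {u}).restrictScalars F : Submodule F V) =
      1 + #((univ.filter fun w : V => w ≠ 0 ∧ w ∈ ℓ).bipartiteAbove
        (fun u w => w ∈ span E {u}) u) := by
    intro u
    rw [← ncard_coe, ← Set.ncard_sdiff_singleton_add_one (a := 0) (by simp), add_comm,
      ← Set.ncard_coe_finset]
    congr 2
    ext
    simp only [bipartiteAbove, Set.mem_sdiff, Set.mem_singleton_iff, SetLike.mem_coe, Submodule.mem_inf,
      restrictScalars_mem, coe_filter, mem_filter, mem_univ, true_and, Set.mem_ofPred_eq]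
    tauto
  have h2 : ∀ w ∈ univ.filter fun w : V => w ≠ 0 ∧ w ∈ ℓ,
      #((univ.filter fun u : V => u ≠ 0 ∧ u ∈ W).bipartiteBelow
        (fun u w => w ∈ span E {u}) w) = c := by
    intro w hw
    obtain ⟨hw, hwℓ⟩ : w ≠ 0 ∧ w ∈ ℓ := by simpa using hw
    rw [← hc w hwℓ hw]
    refine Eq.trans ?_ (ncard_ne_zero_mem_span (W : Set V) hw)
    rw [← Set.ncard_coe_finset]
    congr 1
    ext
    simp [bipartiteBelow]
  have h3 : #(univ.filter fun w : V => w ≠ 0 ∧ w ∈ ℓ) = Nat.card F ^ 2 - 1 := by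
    rw [← hℓ.ncard_sdiff_zero, ← Set.ncard_coe_finset]
    congr 1
    ext; simp
  simp_rw [h1]
  rw [sum_add_distrib, key, sum_congr rfl h2, sum_const, sum_const, h3, smul_eq_mul, smul_eq_mul,
    mul_one]

theorem card_filter_ne_zero_mem [Fintype V] (W : Submodule F V) :
    #{u : V | u ≠ 0 ∧ u ∈ W} + 1 = Nat.card W := by
  rw [← ncard_coe, ← Set.ncard_sdiff_singleton_add_one (s := (W : Set V)) W.zero_mem,
    ← Set.ncard_coe_finset]
  congr 2
  ext
  simp [and_comm]

theorem sum_ncard_lines_le_through [Fintype V] {S : Set (Submodule F V)}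
    (hS : ∀ ℓ ∈ S, IsProjLine ℓ) (W : Submodule F V) :
    ∑ v : V with v ≠ 0 ∧ v ∈ W, {ℓ ∈ {ℓ ∈ S | ℓ ≤ W} | v ∈ ℓ}.ncard =
      {ℓ ∈ S | ℓ ≤ W}.ncard * (Nat.card F ^ 2 - 1) := by
  rw [← sum_ncard_lines_through_ne_zero fun ℓ hℓ => hS ℓ hℓ.1]
  refine sum_subset (fun v => by simp +contextual) fun v hv hv' => ?_
  rw [Set.ncard_eq_zero, Set.eq_empty_iff_forall_notMem]
  rintro ℓ ⟨⟨-, h1⟩, h2⟩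
  simp only [mem_filter, mem_univ, true_and, not_and] at hv hv'
  exact hv' hv (h1 h2)

/-- The counts of lines through each nonzero `u ∈ ℓ^⊥`, summed over `u`. The hypothesis `hc` makes
the sum of `|ℓ ∩ Eu|` depend on `c` only. -/
theorem ncard_vanishingLines_le_orthogonal [Finite F] [Finite E] [Fintype V] {φ : E →ₗ[F] F}
    (hφ : φ ≠ 0) {B : BilinForm E V} (hB : B.IsAlt) (hB' : B.Nondegenerate)
    {ℓ : Submodule F V} (hℓ : IsProjLine ℓ) {c : ℕ}
    (hc : ∀ w ∈ ℓ, w ≠ 0 →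
      {k : E | k ≠ 0 ∧ k • w ∈ (reducedForm φ B).orthogonal ℓ}.ncard = c) :
    ({s ∈ vanishingLines F B | s ≤ (reducedForm φ B).orthogonal ℓ}.ncard *
          (Nat.card F ^ 2 - 1) * (Nat.card F ^ 2 - Nat.card F) +
        #{u | u ≠ 0 ∧ u ∈ (reducedForm φ B).orthogonal ℓ} * Nat.card F) *
        Nat.card F ^ (2 + Module.finrank F E) =
      Nat.card F ^ Module.finrank F V *
        (#{u | u ≠ 0 ∧ u ∈ (reducedForm φ B).orthogonal ℓ} + (Nat.card F ^ 2 - 1) * c) := by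
  rw [← sum_ncard_lines_le_through fun s hs => hs.1, ← sum_natCard_inf_span _ hℓ hc,
    mul_sum, sum_mul, ← smul_eq_mul (#_), ← sum_const, ← sum_add_distrib, sum_mul]
  refine sum_congr rfl fun u hu => ?_
  obtain ⟨hu, huW⟩ : u ≠ 0 ∧ u ∈ (reducedForm φ B).orthogonal ℓ := by simpa using hu
  rw [ncard_vanishingLines_through hB _ hu huW, ncard_orthogonal_inter hφ hB hB' hℓ hu]

end ReducedForm

/-! ### Differences of dual covers, and the cover by vanishing lines -/

section Covers

open Submodule Finset
open scoped Classical

variable {F E V : Type*} [Field F] [Field E] [Algebra F E] [AddCommGroup V]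
  [Module E V] [Module F V] [IsScalarTower F E V]

theorem qNumber_strictMono {q : ℕ} (hq : 0 < q) : StrictMono (qNumber q) :=
  strictMono_nat_of_lt_succ fun k => by
    rw [qNumber, qNumber, sum_range_succ]
    exact Nat.lt_add_of_pos_right (pow_pos hq k)

theorem qNumber_pos {q k : ℕ} (hq : 0 < q) (hk : 0 < k) : 0 < qNumber q k :=
  (Nat.zero_le _).trans_lt (qNumber_strictMono hq hk)

theorem qNumber_mul (q k : ℕ) : (qNumber q k : ℚ) * (q - 1) = q ^ k - 1 := by
  simpa [qNumber] using geom_sum_mul (q : ℚ) k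

/-- All the counts subtract. For `ℓ ∈ S` both carry the extra term `q ^ (r - 3)`, which cancels, as
it must since `ℓ ∉ T \ S`. -/
theorem IsDualCoverOfSymplecticType.sdiff [Finite V] {r : ℕ} {f : BilinForm F V} {a b : ℕ}
    {S T : Set (Submodule F V)} (hS : IsDualCoverOfSymplecticType r f a S)
    (hT : IsDualCoverOfSymplecticType r f b T) (hST : S ⊆ T) (hab : a < b) :
    IsDualCoverOfSymplecticType r f (b - a) (T \ S) := by
  have sub : ∀ A : Submodule F V → Prop, {ℓ ∈ S | A ℓ} ⊆ {ℓ ∈ T | A ℓ} :=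
    fun A ℓ hℓ => ⟨hST hℓ.1, hℓ.2⟩
  have key : ∀ A : Submodule F V → Prop, {ℓ ∈ T \ S | A ℓ}.ncard =
      {ℓ ∈ T | A ℓ}.ncard - {ℓ ∈ S | A ℓ}.ncard := by
    intro A
    rw [← Set.ncard_sdiff (sub A)]
    congr 1
    ext
    simp only [Set.mem_ofPred_eq, Set.mem_sdiff]
    tauto
  have key' : ∀ A : Submodule F V → Prop, ({ℓ ∈ T \ S | A ℓ}.ncard : ℚ) =
      {ℓ ∈ T | A ℓ}.ncard - {ℓ ∈ S | A ℓ}.ncard := by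
    intro A
    rw [key, Nat.cast_sub (Set.ncard_le_ncard (sub A))]
  refine ⟨⟨hT.cover.symplectic, fun ℓ hℓ => hT.cover.subset_lines hℓ.1, by omega,
    (Nat.sub_le b a).trans_lt hT.cover.lt, fun P hP => ?_⟩, fun ℓ h hℓ => ?_, fun ℓ h hℓ => ?_⟩
  · rw [key, hT.cover.card_through P hP, hS.cover.card_through P hP]
  · rw [key', hT.card_of_mem ℓ h hℓ.1, hS.card_of_not_mem ℓ h hℓ.2, Nat.cast_sub hab.le]
    ring
  · rw [key', Nat.cast_sub hab.le]
    by_cases hℓS : ℓ ∈ S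
    · rw [hT.card_of_mem ℓ h (hST hℓS), hS.card_of_mem ℓ h hℓS]
      ring
    · rw [hT.card_of_not_mem ℓ h fun hℓT => hℓ ⟨hℓT, hℓS⟩, hS.card_of_not_mem ℓ h hℓS]
      ring

theorem isSymplecticPolarSpace_reducedForm {r : ℕ} (hr : Module.finrank F V = r + 1)
    {φ : E →ₗ[F] F} (hφ : φ ≠ 0) {B : BilinForm E V} (hB : B.IsAlt) (hB' : B.Nondegenerate) :
    IsSymplecticPolarSpace r (reducedForm φ B) :=
  ⟨hr, reducedForm_isAlt φ hB, reducedForm_nondegenerate hφ hB hB'⟩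

theorem vanishingLines_subset_isotropicLines (φ : E →ₗ[F] F) (B : BilinForm E V) :
    vanishingLines F B ⊆ isotropicLines (reducedForm φ B) := by
  refine fun ℓ hℓ => ⟨hℓ.1, fun v hv => ?_⟩
  rw [LinearMap.BilinForm.mem_orthogonal_iff]
  intro u hu
  simp [hℓ.2 u hu v hv]

theorem ncard_vanishingLines_through_mul [Finite F] [Finite E] [Fintype V] {φ : E →ₗ[F] F}
    (hφ : φ ≠ 0) {B : BilinForm E V} (hB : B.IsAlt) (hB' : B.Nondegenerate) {u : V}
    (hu : u ≠ 0) :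
    ({ℓ ∈ vanishingLines F B | u ∈ ℓ}.ncard * (Nat.card F ^ 2 - Nat.card F) + Nat.card F) *
      Nat.card F ^ Module.finrank F E = Nat.card F ^ Module.finrank F V := by
  have h := ncard_vanishingLines_through hB (⊤ : Submodule F V) hu mem_top
  simp only [le_top, and_true, mem_top, true_and] at h
  have h1 : {v | B u v = 0} =
      ((reducedForm φ B).orthogonal ((span E {u}).restrictScalars F) : Set V) := by
    ext v
    exact (mem_orthogonal_span_iff hφ).symm
  have h2 : {ℓ ∈ vanishingLines F B | u ∈ ℓ} = {ℓ ∈ {ℓ | ℓ ∈ vanishingLines F B} | u ∈ ℓ} := rfl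
  rw [h2, h, h1, ncard_coe, ← natCard_span_restrictScalars hu,
    natCard_orthogonal_mul (reducedForm_nondegenerate hφ hB hB')]

theorem eq_span_singleton_of_finrank_eq_one {P : Submodule F V} (hP : Module.finrank F P = 1)
    {u : V} (hu : u ≠ 0) (huP : u ∈ P) : P = span F {u} := by
  have : Module.Finite F P := Module.finite_of_finrank_pos (by omega)
  refine (eq_of_le_of_finrank_eq (span_le.2 (by simpa using huP)) ?_).symm
  rw [hP, finrank_span_singleton hu]

theorem exists_mem_ne_zero_of_finrank_pos {P : Submodule F V} (hP : 0 < Module.finrank F P) :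
    ∃ u ∈ P, u ≠ 0 := by
  refine exists_mem_ne_zero_of_ne_bot ?_
  rintro rfl
  simp at hP

theorem ncard_through_eq {S : Set (Submodule F V)} {m : ℕ}
    (h : ∀ u : V, u ≠ 0 → {ℓ ∈ S | u ∈ ℓ}.ncard = m) (P : Submodule F V)
    (hP : Module.finrank F P = 1) : {ℓ ∈ S | P ≤ ℓ}.ncard = m := by
  obtain ⟨u, huP, hu⟩ := exists_mem_ne_zero_of_finrank_pos (P := P) (by omega)
  rw [← h u hu, eq_span_singleton_of_finrank_eq_one hP hu huP]
  simp only [span_singleton_le_iff_mem]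

/-- Here `X = q ^ (r - 3)`, `Y = |E|`, `Z = q ^ (r - [E : F])`, `M` counts the nonzero vectors of
`ℓ^⊥`, `D` the required lines, and `b` is 1 or 0 according to whether `B` vanishes on `ℓ`. -/
theorem dual_count_identity {q X Y Z M c D : ℚ} {b : ℚ} (hq : 1 < q) (hY : 0 < Y)
    (hXYZ : X * q ^ 3 = Z * Y) (hM : M + 1 = X * q ^ 2)
    (hc : (c + 1) * q = Y + b * (Y * (q - 1)))
    (H : (D * (q ^ 2 - 1) * (q ^ 2 - q) + M * q) * (q ^ 2 * Y) =
      X * q ^ 4 * (M + (q ^ 2 - 1) * c)) :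
    D * (q + 1) * (q - 1) ^ 2 = (Z - 1) * (X - 1) + b * (X * (q ^ 2 - 1) * (q - 1)) := by
  have h : q ^ 3 * Y ≠ 0 := by positivity
  apply mul_left_cancel₀ h
  obtain rfl : M = X * q ^ 2 - 1 := by linarith
  linear_combination H + q ^ 3 * X * (q ^ 2 - 1) * hc + q ^ 3 * (X - 1) * hXYZ

theorem isDualCover_vanishingLines [Finite F] [Finite E] [Finite V] {φ : E →ₗ[F] F}
    (hφ : φ ≠ 0) {B : BilinForm E V} (hB : B.IsAlt) (hB' : B.Nondegenerate) {r : ℕ}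
    (hr : Module.finrank F V = r + 1) (hr3 : 3 ≤ r) (hE : Module.finrank F E < r) :
    IsDualCoverOfSymplecticType r (reducedForm φ B)
      (qNumber (Nat.card F) (r - Module.finrank F E)) (vanishingLines F B) := by
  have := Fintype.ofFinite V
  have : Module.Finite F E := Module.Finite.of_finite
  have he : 0 < Module.finrank F E := Module.finrank_pos
  have hq : 1 < Nat.card F := Finite.one_lt_card
  have hqQ : (1 : ℚ) < Nat.card F := by exact_mod_cast hq
  have c1 : ((Nat.card F ^ 2 - 1 : ℕ) : ℚ) = (Nat.card F : ℚ) ^ 2 - 1 := by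
    rw [Nat.cast_sub (Nat.one_le_pow _ _ (by omega))]; push_cast; ring
  have c2 : ((Nat.card F ^ 2 - Nat.card F : ℕ) : ℚ) = (Nat.card F : ℚ) ^ 2 - Nat.card F := by
    rw [Nat.cast_sub (Nat.le_self_pow two_ne_zero _)]; push_cast; ring
  have hm := qNumber_mul (Nat.card F) (r - Module.finrank F E)
  have hQ := qNumber_mul (Nat.card F) (r - 3)
  have hM : ∀ ℓ : Submodule F V, IsProjLine ℓ →
      ((#{u | u ≠ 0 ∧ u ∈ (reducedForm φ B).orthogonal ℓ} : ℕ) : ℚ) + 1 =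
        (Nat.card F : ℚ) ^ (r - 3) * (Nat.card F : ℚ) ^ 2 := by
    intro ℓ hℓ
    have : Module.Finite F V := Module.Finite.of_finite
    have h := card_filter_ne_zero_mem ((reducedForm φ B).orthogonal ℓ)
    rw [natCard_eq_pow, LinearMap.BilinForm.finrank_orthogonal
      (reducedForm_nondegenerate hφ hB hB'), hℓ, hr,
      show r + 1 - 2 = r - 3 + 2 by omega, pow_add] at h
    exact_mod_cast h
  have hX : (Nat.card F : ℚ) ^ (r - 3) * (Nat.card F : ℚ) ^ 3 =
      (Nat.card F : ℚ) ^ (r - Module.finrank F E) * (Nat.card F : ℚ) ^ Module.finrank F E := by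
    rw [← pow_add, ← pow_add]
    congr 1
    omega
  have hN : (Nat.card F : ℚ) ^ (r + 1) = (Nat.card F : ℚ) ^ (r - 3) * (Nat.card F : ℚ) ^ 4 := by
    rw [← pow_add]
    congr 1
    omega
  have hY : (0 : ℚ) < (Nat.card F : ℚ) ^ Module.finrank F E := by positivity
  have hcount : ∀ (ℓ : Submodule F V) (_ : IsProjLine ℓ) (c : ℕ) (b : ℚ)
      (_ : ∀ w ∈ ℓ, w ≠ 0 →
        {k : E | k ≠ 0 ∧ k • w ∈ (reducedForm φ B).orthogonal ℓ}.ncard = c)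
      (_ : ((c : ℚ) + 1) * Nat.card F = (Nat.card F : ℚ) ^ Module.finrank F E +
        b * ((Nat.card F : ℚ) ^ Module.finrank F E * (Nat.card F - 1))),
      ({s ∈ vanishingLines F B | s ≤ (reducedForm φ B).orthogonal ℓ}.ncard : ℚ) =
        (qNumber (Nat.card F) (r - Module.finrank F E) : ℚ) *
          (qNumber (Nat.card F) (r - 3) : ℚ) / ((Nat.card F : ℚ) + 1) +
          b * (Nat.card F : ℚ) ^ (r - 3) := by
    intro ℓ hℓ c b hc hcb
    have H := ncard_vanishingLines_le_orthogonal hφ hB hB' hℓ hc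
    rw [hr] at H
    replace H := congrArg (Nat.cast : ℕ → ℚ) H
    push_cast [c1, c2, pow_add _ 2 _] at H
    rw [hN] at H
    have h := dual_count_identity hqQ hY hX (hM ℓ hℓ) hcb H
    have h1 : (Nat.card F : ℚ) + 1 ≠ 0 := by positivity
    have h2 : ((Nat.card F : ℚ) - 1) ^ 2 ≠ 0 := pow_ne_zero _ (by linarith)
    rw [← hm, ← hQ] at h
    field_simp
    apply mul_right_cancel₀ h2
    linear_combination h
  refine ⟨⟨isSymplecticPolarSpace_reducedForm hr hφ hB hB',
    vanishingLines_subset_isotropicLines φ B, qNumber_pos (by omega) (by omega),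
    qNumber_strictMono (by omega) (by omega), ncard_through_eq fun u hu => ?_⟩,
    fun ℓ hℓ h => ?_, fun ℓ hℓ h => ?_⟩
  · have h := ncard_vanishingLines_through_mul hφ hB hB' hu
    rw [hr] at h
    replace h := congrArg (Nat.cast : ℕ → ℚ) h
    push_cast [c2] at h
    rw [hN] at h
    have h1 : (Nat.card F : ℚ) * ((Nat.card F : ℚ) - 1) *
        (Nat.card F : ℚ) ^ Module.finrank F E ≠ 0 :=
      mul_ne_zero (mul_ne_zero (by linarith) (by linarith)) hY.ne'
    have h2 : ({ℓ ∈ vanishingLines F B | u ∈ ℓ}.ncard : ℚ) =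
        (qNumber (Nat.card F) (r - Module.finrank F E) : ℚ) := by
      apply mul_left_cancel₀ h1
      linear_combination h + (Nat.card F : ℚ) * hX -
        (Nat.card F : ℚ) * (Nat.card F : ℚ) ^ Module.finrank F E * hm
    exact_mod_cast h2
  · have h1 : ∀ w ∈ ℓ, w ≠ 0 →
        {k : E | k ≠ 0 ∧ k • w ∈ (reducedForm φ B).orthogonal ℓ}.ncard =
          Nat.card E - 1 := by
      intro w hw _
      rw [setOf_smul_mem_orthogonal_of_mem h hw, Set.ncard_sdiff_singleton_of_mem (by simp),
        Set.ncard_univ]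
    rw [hcount ℓ hℓ _ 1 h1, one_mul]
    rw [Nat.cast_sub Nat.card_pos, Module.natCard_eq_pow_finrank (K := F) (V := E)]
    push_cast
    ring
  -- The size of the kernel does not depend on `b ≠ 0`, so `b = 1` supplies a value of `c` valid for
  -- every `w`.
  · obtain ⟨c, hc⟩ : ∃ c : ℕ, (c + 1) * Nat.card F = Nat.card F ^ Module.finrank F E :=
      ⟨_, ncard_ne_zero_apply_mul_eq_zero hφ one_ne_zero⟩
    have h1 : ∀ w ∈ ℓ, w ≠ 0 →
        {k : E | k ≠ 0 ∧ k • w ∈ (reducedForm φ B).orthogonal ℓ}.ncard = c := by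
      intro w hw hw0
      obtain ⟨b, hb, hs⟩ := exists_setOf_smul_mem_orthogonal_of_notMem φ hB hℓ h hw0 hw
      have := ncard_ne_zero_apply_mul_eq_zero hφ hb
      rw [hs]
      exact Nat.succ_injective (Nat.eq_of_mul_eq_mul_right (by omega) (this.trans hc.symm))
    rw [hcount ℓ hℓ c 0 h1, zero_mul, add_zero]
    rw [zero_mul, add_zero]
    exact_mod_cast hc

end Covers

/-! ### Dye's spread and its conjugate lines -/

section DyeSpread

open Submodule Finset
open scoped Classical

variable {F K V : Type*} [Field F] [Field K] [Algebra F K] [AddCommGroup V]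
  [Module K V] [Module F V] [IsScalarTower F K V]

theorem mem_dyeSpread_iff_of_mem {s : Submodule F V} {u : V} (hu : u ≠ 0) (hus : u ∈ s) :
    s ∈ dyeSpread F K V ↔ s = (span K {u}).restrictScalars F := by
  constructor
  · rintro ⟨p, hp, rfl⟩
    rw [eq_span_singleton_of_finrank_eq_one hp hu hus]
  · rintro rfl
    exact ⟨_, finrank_span_singleton hu, rfl⟩

theorem span_restrictScalars_mem_dyeSpread {u : V} (hu : u ≠ 0) :
    (span K {u}).restrictScalars F ∈ dyeSpread F K V := ⟨_, finrank_span_singleton hu, rfl⟩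

theorem isProjLine_of_mem_dyeSpread (hK : Module.finrank F K = 2) {s : Submodule F V}
    (hs : s ∈ dyeSpread F K V) : IsProjLine s := by
  obtain ⟨p, hp, rfl⟩ := hs
  have h := Module.finrank_mul_finrank F K p
  rw [hK, hp] at h
  exact h.symm

theorem dyeSpread_subset_vanishingLines (hK : Module.finrank F K = 2) {B : BilinForm K V}
    (hB : B.IsAlt) : dyeSpread F K V ⊆ vanishingLines F B := by
  refine fun s hs => ⟨isProjLine_of_mem_dyeSpread hK hs, ?_⟩
  obtain ⟨p, hp, rfl⟩ := hs
  obtain ⟨w, hwp, hw⟩ := exists_mem_ne_zero_of_finrank_pos (P := p) (by omega)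
  rw [eq_span_singleton_of_finrank_eq_one hp hw hwp]
  intro u hu v hv
  obtain ⟨a, rfl⟩ := mem_span_singleton.1 hu
  obtain ⟨b, rfl⟩ := mem_span_singleton.1 hv
  simp [hB.self_eq_zero]

theorem vanishingLines_iff_of_mem [Finite V] {B : BilinForm K V} (hB : B.IsAlt)
    {ℓ : Submodule F V} (hℓ : IsProjLine ℓ) {w : V} (hw : w ≠ 0) (hwℓ : w ∈ ℓ) :
    ℓ ∈ vanishingLines F B ↔ ∀ y ∈ ℓ, B w y = 0 := by
  refine ⟨fun h => h.2 w hwℓ, fun h => ⟨hℓ, ?_⟩⟩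
  obtain ⟨y, hy, hyw⟩ := hℓ.exists_notMem_span hw
  rw [hℓ.eq_span_pair hw hyw hwℓ hy]
  exact LinearMap.BilinForm.apply_eq_zero_of_mem_span_pair hB (h y hy)

/-- With `w` a nonzero common vector, `s = Kw`, so the left side says `B w y = 0` on `ℓ`; as `B` is
alternating and `ℓ` is a line through `w`, `B` then vanishes on `ℓ`. The right side no longer
involves `s`. -/
theorem le_orthogonal_iff_of_mem_dyeSpread [Finite V] {φ : K →ₗ[F] F} (hφ : φ ≠ 0)
    {B : BilinForm K V} (hB : B.IsAlt) {ℓ s : Submodule F V} (hℓ : IsProjLine ℓ)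
    (hs : s ∈ dyeSpread F K V) (hsℓ : s ⊓ ℓ ≠ ⊥) :
    ℓ ≤ (reducedForm φ B).orthogonal s ↔ ℓ ∈ vanishingLines F B := by
  obtain ⟨w, ⟨hws, hwℓ⟩, hw⟩ := exists_mem_ne_zero_of_ne_bot hsℓ
  rw [(mem_dyeSpread_iff_of_mem hw hws).1 hs, vanishingLines_iff_of_mem hB hℓ hw hwℓ]
  exact forall₂_congr fun y _ => mem_orthogonal_span_iff hφ

theorem exists_mem_dyeSpread_inf_ne_bot {ℓ : Submodule F V} (hℓ : IsProjLine ℓ) :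
    ∃ s ∈ dyeSpread F K V, s ⊓ ℓ ≠ ⊥ := by
  obtain ⟨w, hwℓ, hw⟩ := exists_mem_ne_zero_of_finrank_pos (P := ℓ) (by rw [hℓ]; omega)
  exact ⟨_, span_restrictScalars_mem_dyeSpread hw,
    (Submodule.ne_bot_iff _).2 ⟨w, ⟨mem_span_singleton_self w, hwℓ⟩, hw⟩⟩

theorem nonConjugateLines_dyeSpread [Finite V] {φ : K →ₗ[F] F} (hφ : φ ≠ 0)
    {B : BilinForm K V} (hB : B.IsAlt) :
    nonConjugateLines (reducedForm φ B) (dyeSpread F K V) =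
      isotropicLines (reducedForm φ B) \ vanishingLines F B := by
  ext ℓ
  refine and_congr_right fun hℓ => ⟨fun h h' => ?_, fun h s hs hsℓ => ?_⟩
  · obtain ⟨s, hs, hsℓ⟩ := exists_mem_dyeSpread_inf_ne_bot (K := K) hℓ.1
    exact h s hs hsℓ ((le_orthogonal_iff_of_mem_dyeSpread hφ hB hℓ.1 hs hsℓ).2 h')
  · rwa [le_orthogonal_iff_of_mem_dyeSpread hφ hB hℓ.1 hs hsℓ]

theorem conjugateLines_dyeSpread [Finite V] {φ : K →ₗ[F] F} (hφ : φ ≠ 0)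
    {B : BilinForm K V} (hB : B.IsAlt) :
    conjugateLines (reducedForm φ B) (dyeSpread F K V) =
      vanishingLines F B \ dyeSpread F K V := by
  ext ℓ
  constructor
  · rintro ⟨hℓ, hℓS, h⟩
    obtain ⟨s, hs, hsℓ⟩ := exists_mem_dyeSpread_inf_ne_bot (K := K) hℓ.1
    exact ⟨(le_orthogonal_iff_of_mem_dyeSpread hφ hB hℓ.1 hs hsℓ).1 (h s hs hsℓ), hℓS⟩
  · rintro ⟨hℓ, hℓS⟩
    exact ⟨vanishingLines_subset_isotropicLines φ B hℓ, hℓS, fun s hs hsℓ =>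
      (le_orthogonal_iff_of_mem_dyeSpread hφ hB hℓ.1 hs hsℓ).2 hℓ⟩

theorem isotropicLines_eq_vanishingLines {f : BilinForm F V} :
    isotropicLines f = vanishingLines F f := by
  ext ℓ
  refine and_congr_right fun _ => ⟨fun h u hu v hv => ?_, fun h v hv => ?_⟩
  · exact LinearMap.BilinForm.mem_orthogonal_iff.1 (h hv) u hu
  · exact LinearMap.BilinForm.mem_orthogonal_iff.2 fun u hu => h u hu v hv

theorem reducedForm_id (f : BilinForm F V) : reducedForm LinearMap.id f = f := rfl

theorem ncard_dyeSpread_through {u : V} (hu : u ≠ 0) :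
    {s ∈ dyeSpread F K V | u ∈ s}.ncard = 1 := by
  rw [Set.ncard_eq_one]
  refine ⟨(span K {u}).restrictScalars F, ?_⟩
  ext s
  constructor
  · rintro ⟨h1, h2⟩
    exact (mem_dyeSpread_iff_of_mem hu h2).1 h1
  · rintro rfl
    exact ⟨span_restrictScalars_mem_dyeSpread hu, mem_span_singleton_self u⟩

/-- Both sides say that `B y u = 0` for all `y ∈ ℓ`. -/
theorem span_le_orthogonal_iff {φ : K →ₗ[F] F} (hφ : φ ≠ 0) {B : BilinForm K V}
    {ℓ : Submodule F V} {u : V} :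
    (span K {u}).restrictScalars F ≤ (reducedForm φ B).orthogonal ℓ ↔
      u ∈ (reducedForm φ B).orthogonal ((span K (ℓ : Set V)).restrictScalars F) := by
  have h1 : (span K {u}).restrictScalars F ≤ (reducedForm φ B).orthogonal ℓ ↔
      ∀ y ∈ ℓ, B y u = 0 := by
    simp only [SetLike.le_def, LinearMap.BilinForm.mem_orthogonal_iff, reducedForm_apply,
      restrictScalars_mem]
    constructor
    · refine fun h y hy => LinearMap.eq_zero_of_forall_apply_mul_eq_zero hφ fun k => ?_
      simpa using h (mem_span_singleton.2 ⟨k, rfl⟩) y hy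
    · intro h x hx y hy
      obtain ⟨k, rfl⟩ := mem_span_singleton.1 hx
      simp [h y hy]
  rw [h1]
  simp only [LinearMap.BilinForm.mem_orthogonal_iff, reducedForm_apply, restrictScalars_mem]
  constructor
  · intro h x hx
    have : B x u = 0 := by
      induction hx using span_induction with
      | mem x hx => exact h x hx
      | zero => simp
      | add x y _ _ hx hy => simp [hx, hy]
      | smul k x _ hx => simp [hx]
    simp [this]
  · refine fun h y hy => LinearMap.eq_zero_of_forall_apply_mul_eq_zero hφ fun k => ?_
    simpa using h (k • y) (smul_mem _ k (subset_span hy))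

/-- Each nonzero `u` lies on the single spread member `Ku`, and `Ku ≤ ℓ^⊥` exactly when `u ∈
(Kℓ)^⊥`. So the members counted partition the nonzero vectors of `(Kℓ)^⊥`. -/
theorem ncard_dyeSpread_le_orthogonal_mul [Fintype V] (hK : Module.finrank F K = 2)
    {φ : K →ₗ[F] F} (hφ : φ ≠ 0) {B : BilinForm K V} (hB : B.IsAlt) (hB' : B.Nondegenerate)
    (ℓ : Submodule F V) :
    ({s ∈ dyeSpread F K V | s ≤ (reducedForm φ B).orthogonal ℓ}.ncard *
        (Nat.card F ^ 2 - 1) + 1) * Nat.card ((span K (ℓ : Set V)).restrictScalars F) =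
      Nat.card F ^ Module.finrank F V := by
  rw [← natCard_orthogonal_mul (reducedForm_nondegenerate hφ hB hB')
    ((span K (ℓ : Set V)).restrictScalars F),
    ← card_filter_ne_zero_mem ((reducedForm φ B).orthogonal _),
    ← sum_ncard_lines_through_ne_zero fun s hs => isProjLine_of_mem_dyeSpread hK hs.1]
  congr 2
  rw [← filter_filter, ← Nat.cast_id (#_), ← sum_boole]
  refine sum_congr rfl fun u hu => ?_
  replace hu : u ≠ 0 := by simpa using hu
  have h1 : {s ∈ {s ∈ dyeSpread F K V | s ≤ (reducedForm φ B).orthogonal ℓ} | u ∈ s} =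
      {s | s = (span K {u}).restrictScalars F ∧ s ≤ (reducedForm φ B).orthogonal ℓ} := by
    ext s
    constructor
    · rintro ⟨⟨h1, h2⟩, h3⟩
      exact ⟨(mem_dyeSpread_iff_of_mem hu h3).1 h1, h2⟩
    · rintro ⟨rfl, h⟩
      exact ⟨⟨span_restrictScalars_mem_dyeSpread hu, h⟩, mem_span_singleton_self u⟩
  rw [h1]
  split_ifs with h
  · rw [Set.ncard_eq_one]
    refine ⟨(span K {u}).restrictScalars F, ?_⟩
    ext s
    constructor
    · exact fun h => h.1
    · rintro rfl
      exact ⟨rfl, (span_le_orthogonal_iff hφ).2 h⟩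
  · rw [Set.ncard_eq_zero, Set.eq_empty_iff_forall_notMem]
    rintro s ⟨rfl, h'⟩
    exact h ((span_le_orthogonal_iff hφ).1 h')

theorem natCard_span_of_mem_dyeSpread [Finite V] (hK : Module.finrank F K = 2)
    {ℓ : Submodule F V} (hℓ : ℓ ∈ dyeSpread F K V) :
    Nat.card ((span K (ℓ : Set V)).restrictScalars F) = Nat.card F ^ 2 := by
  have h := isProjLine_of_mem_dyeSpread hK hℓ
  obtain ⟨p, hp, rfl⟩ := hℓ
  rw [← h, ← natCard_eq_pow, coe_restrictScalars, span_eq]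

theorem natCard_span_of_notMem_dyeSpread [Finite K] [Finite V] (hK : Module.finrank F K = 2)
    {ℓ : Submodule F V} (hℓ : IsProjLine ℓ) (h : ℓ ∉ dyeSpread F K V) :
    Nat.card ((span K (ℓ : Set V)).restrictScalars F) = Nat.card F ^ 4 := by
  have : Module.Finite F V := Module.Finite.of_finite
  have : Module.Finite F K := Module.Finite.of_finite
  obtain ⟨w, hwℓ, hw⟩ := exists_mem_ne_zero_of_finrank_pos (P := ℓ) (by rw [hℓ]; omega)
  -- Otherwise `ℓ ≤ Kw`, and equal `F`-dimension 2 would make `ℓ` the spread member `Kw`.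
  obtain ⟨y, hy, hyw⟩ : ∃ y ∈ ℓ, y ∉ span K {w} := by
    by_contra! h'
    refine h ((mem_dyeSpread_iff_of_mem hw hwℓ).2 (eq_of_le_of_finrank_eq h' ?_))
    rw [hℓ, isProjLine_of_mem_dyeSpread hK (span_restrictScalars_mem_dyeSpread hw)]
  have hyw' : y ∉ span F {w} := fun hy => hyw (span_le_restrictScalars F K _ hy)
  have hs : span K (ℓ : Set V) = span K {w, y} := by
    rw [hℓ.eq_span_pair hw hyw' hwℓ hy, span_span_of_tower]
  have h1 : Nat.card (span K {w, y}) = Nat.card K ^ 2 := by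
    rw [natCard_eq_pow, isProjLine_span_pair hw hyw]
  rw [hs]
  refine h1.trans ?_
  rw [Module.natCard_eq_pow_finrank (K := F) (V := K), hK, ← pow_mul]

theorem isDualCover_dyeSpread [Finite F] [Finite K] [Finite V] (hK : Module.finrank F K = 2)
    {φ : K →ₗ[F] F} (hφ : φ ≠ 0) {B : BilinForm K V} (hB : B.IsAlt) (hB' : B.Nondegenerate)
    {r : ℕ} (hr : Module.finrank F V = r + 1) (hr3 : 3 ≤ r) :
    IsDualCoverOfSymplecticType r (reducedForm φ B) 1 (dyeSpread F K V) := by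
  have := Fintype.ofFinite V
  have hq : 1 < Nat.card F := Finite.one_lt_card
  have hqQ : (1 : ℚ) < Nat.card F := by exact_mod_cast hq
  have c1 : ((Nat.card F ^ 2 - 1 : ℕ) : ℚ) = (Nat.card F : ℚ) ^ 2 - 1 := by
    rw [Nat.cast_sub (Nat.one_le_pow _ _ (by omega))]; push_cast; ring
  have hQ := qNumber_mul (Nat.card F) (r - 3)
  have hN : (Nat.card F : ℚ) ^ (r + 1) = (Nat.card F : ℚ) ^ (r - 3) * (Nat.card F : ℚ) ^ 4 := by
    rw [← pow_add]
    congr 1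
    omega
  have h1 : (Nat.card F : ℚ) + 1 ≠ 0 := by positivity
  have h2 : (Nat.card F : ℚ) - 1 ≠ 0 := by linarith
  refine ⟨⟨isSymplecticPolarSpace_reducedForm hr hφ hB hB',
    (dyeSpread_subset_vanishingLines hK hB).trans (vanishingLines_subset_isotropicLines φ B),
    one_pos, ?_, ncard_through_eq fun u hu => ncard_dyeSpread_through hu⟩,
    fun ℓ hℓ h => ?_, fun ℓ hℓ h => ?_⟩
  -- The bound `1 < θ_{r-1,q}` is monotonicity, as `1 = qNumber q 1`.
  · have h := qNumber_strictMono (q := Nat.card F) (by omega) (show 1 < r by omega)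
    simpa [qNumber] using h
  · have H := ncard_dyeSpread_le_orthogonal_mul hK hφ hB hB' ℓ
    rw [natCard_span_of_mem_dyeSpread hK h, hr] at H
    replace H := congrArg (Nat.cast : ℕ → ℚ) H
    push_cast [c1] at H
    rw [hN] at H
    field_simp
    have h3 : (Nat.card F : ℚ) ^ 2 * ((Nat.card F : ℚ) - 1) ≠ 0 :=
      mul_ne_zero (by positivity) h2
    apply mul_left_cancel₀ h3
    push_cast
    linear_combination H - (Nat.card F : ℚ) ^ 2 * hQ
  · have H := ncard_dyeSpread_le_orthogonal_mul hK hφ hB hB' ℓ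
    rw [natCard_span_of_notMem_dyeSpread hK hℓ h, hr] at H
    replace H := congrArg (Nat.cast : ℕ → ℚ) H
    push_cast [c1] at H
    rw [hN] at H
    field_simp
    have h3 : (Nat.card F : ℚ) ^ 4 * ((Nat.card F : ℚ) - 1) ≠ 0 :=
      mul_ne_zero (by positivity) h2
    apply mul_left_cancel₀ h3
    push_cast
    linear_combination H - (Nat.card F : ℚ) ^ 4 * hQ

end DyeSpread

/-! ### The three covers -/

theorem mainTheorem7 {F K V : Type*} [Field F] [Finite F] [Field K] [Algebra F K]
    [AddCommGroup V] [Module K V] [Module F V] [IsScalarTower F K V]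
    (hK : Module.finrank F K = 2)
    (n : ℕ) (hn : 2 ≤ n) (hV : Module.finrank K V = 2 * n)
    (B : LinearMap.BilinForm K V) (hB : B.IsAlt) (hB' : B.Nondegenerate)
    (φ : K →ₗ[F] F) (hφ : φ ≠ 0) :
    IsDualCoverOfSymplecticType (4 * n - 1) (reducedForm φ B) 1 (dyeSpread F K V) ∧
    (∃ m : ℕ, IsDualCoverOfSymplecticType (4 * n - 1) (reducedForm φ B) m
      (nonConjugateLines (reducedForm φ B) (dyeSpread F K V))) ∧
    (∃ m : ℕ, IsDualCoverOfSymplecticType (4 * n - 1) (reducedForm φ B) m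
      (conjugateLines (reducedForm φ B) (dyeSpread F K V))) := by
  have : Module.Finite F K := Module.finite_of_finrank_pos (by omega)
  have : Module.Finite K V := Module.finite_of_finrank_pos (by omega)
  have : Finite K := Module.finite_of_finite F
  have : Finite V := Module.finite_of_finite K
  have hq : 1 < Nat.card F := Finite.one_lt_card
  have hr : Module.finrank F V = 4 * n - 1 + 1 := by
    rw [← Module.finrank_mul_finrank F K V, hK, hV]
    omega
  have hS := isDualCover_dyeSpread hK hφ hB hB' hr (by omega)
  have hT := isDualCover_vanishingLines hφ hB hB' hr (by omega) (by omega)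
  -- With `E = F` and `φ = id`, the vanishing lines of `f` are all its totally isotropic lines.
  have hI := isDualCover_vanishingLines (E := F) (φ := LinearMap.id) (B := reducedForm φ B)
    (fun h => one_ne_zero (LinearMap.congr_fun h (1 : F))) (reducedForm_isAlt φ hB)
    (reducedForm_nondegenerate hφ hB hB') hr (by omega) (by rw [Module.finrank_self]; omega)
  rw [reducedForm_id, ← isotropicLines_eq_vanishingLines, Module.finrank_self] at hI
  rw [hK] at hT
  refine ⟨hS, ?_, ?_⟩
  · rw [nonConjugateLines_dyeSpread hφ hB]
    -- Here `m = θ_{4n-3,q} - θ_{4n-4,q} = q ^ (4n - 3)`.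
    exact ⟨_, hT.sdiff hI (vanishingLines_subset_isotropicLines φ B)
      (qNumber_strictMono (by omega) (by omega))⟩
  · rw [conjugateLines_dyeSpread hφ hB]
    -- Here `m = θ_{4n-4,q} - 1`.
    refine ⟨_, hS.sdiff hT (dyeSpread_subset_vanishingLines hK hB) ?_⟩
    simpa [qNumber] using qNumber_strictMono (q := Nat.card F) (by omega)
      (show 1 < 4 * n - 1 - 2 by omega)
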